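/- **Theorem 1.2.** For permutations $g,h$ of a finite set with $n$ elements put $d_n(g,h)=n-|\mathrm{fix}(gh^{-1})|$, where $\mathrm{fix}(x)$ is the set of fixed points of $x$. For a nonempty set $C$ of permutations put $d_n(v,C)=\min\{d_n(v,c)\mid c\in C\}$, and let $\mathrm{Cr}_n(C)=\max_v d_n(v,C)$ be its covering radius, where $v$ runs over all permutations of the set. Let $q=p^f$ with $p$ prime. Equip $V=\mathbb F_{q^2}^3$ with the unitary form $x_1y_3^q+x_2y_2^q+x_3y_1^q$, let $\Omega$ be the set of totally isotropic one-dimensional subspaces of $V$, and let $\mathrm{PGU}(3,q)$ and $\mathrm{PSU}(3,q)$ be the groups of permutations of $\Omega$ induced by the linear maps of $V$ that preserve the form, respectively by those among them of determinant $1$. Let $h$ be the permutation $\langle(x_1,x_2,x_3)\rangle\mapsto\langle(x_1^p,x_2^p,x_3^p)\rangle$ of $\Omega$. Then $|\Omega|=q^3+1$ and $$q^3-p\le \mathrm{Cr}_{q^3+1}(\mathrm{PGU}(3,q))\le \mathrm{Cr}_{q^3+1}(\mathrm{PSU}(3,q))\le q^3-\gcd(2,q).$$ In particular, if $q$ is even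 then $$\mathrm{Cr}_{q^3+1}(\mathrm{PGU}(3,q))=\mathrm{Cr}_{q^3+1}(\mathrm{PSU}(3,q))=q^3-2.$$ Moreover, $d_{q^3+1}(h,\mathrm{PGU}(3,q))=q^3-p$. -/

import Mathlib

open scoped LinearAlgebra.Projectivization

section Hamming

variable {α : Type*}

/-- The Hamming distance `n - |fix (g h⁻¹)|` between two permutations of a finite set with `n`
elements. -/
noncomputable def permDist (g h : Equiv.Perm α) : ℕ :=
  Nat.card α - Set.ncard {x : α | (g * h⁻¹) x = x}

/-- The distance `min {d (v, c) | c ∈ C}` from the permutation `v` to the (nonempty) set `C`. -/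
noncomputable def permDistSet (v : Equiv.Perm α) (C : Set (Equiv.Perm α)) : ℕ :=
  sInf {d : ℕ | ∃ c ∈ C, permDist v c = d}

/-- The covering radius `max {d (v, C) | v a permutation}` of the (nonempty) set `C` of permutations
of a finite set. -/
noncomputable def coveringRadius (C : Set (Equiv.Perm α)) : ℕ :=
  sSup {r : ℕ | ∃ v : Equiv.Perm α, permDistSet v C = r}

end Hamming

namespace Unitary3

section Form

variable {K : Type*} [Field K]

/-- The form `x₁ y₃^q + x₂ y₂^q + x₃ y₁^q` on `K³`. It is the unitary form when `|K| = q²`. -/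
def form (q : ℕ) (x y : Fin 3 → K) : K :=
  x 0 * y 2 ^ q + x 1 * y 1 ^ q + x 2 * y 0 ^ q

theorem form_smul_smul (q : ℕ) (a b : K) (x y : Fin 3 → K) :
    form q (a • x) (b • y) = a * b ^ q * form q x y := by
  simp only [form, Pi.smul_apply, smul_eq_mul]
  ring

variable (K)

/-- The set of totally isotropic one-dimensional subspaces of `K³`, i.e. the points of the
Hermitian curve. -/
def isotropicPoints (q : ℕ) : Set (ℙ K (Fin 3 → K)) :=
  {P | ∀ x ∈ P.submodule, ∀ y ∈ P.submodule, form q x y = 0}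

variable {K}

theorem mk_mem_isotropicPoints {q : ℕ} {v : Fin 3 → K} (hv : v ≠ 0) :
    Projectivization.mk K v hv ∈ isotropicPoints K q ↔ form q v v = 0 := by
  simp only [isotropicPoints, Set.mem_ofPred_eq, Projectivization.submodule_mk]
  constructor
  · intro h
    exact h v (Submodule.mem_span_singleton_self v) v (Submodule.mem_span_singleton_self v)
  · intro h x hx y hy
    obtain ⟨a, rfl⟩ := Submodule.mem_span_singleton.1 hx
    obtain ⟨b, rfl⟩ := Submodule.mem_span_singleton.1 hy
    rw [form_smul_smul, h, mul_zero]

variable (K)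

/-- The general unitary group: all invertible linear maps of `K³` that preserve the form. -/
def GU (q : ℕ) : Subgroup ((Fin 3 → K) ≃ₗ[K] (Fin 3 → K)) where
  carrier := {g | ∀ x y, form q (g x) (g y) = form q x y}
  one_mem' := fun _ _ => rfl
  mul_mem' := fun {g h} hg hh x y => by
    rw [LinearEquiv.mul_apply, LinearEquiv.mul_apply, hg, hh]
  inv_mem' := fun {g} hg x y => by
    have h := hg (g⁻¹ x) (g⁻¹ y)
    rw [← LinearEquiv.mul_apply, ← LinearEquiv.mul_apply, mul_inv_cancel] at h
    exact h.symm

/-- The special unitary group: the elements of determinant `1` of the general unitary group. -/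
noncomputable def SU (q : ℕ) : Subgroup (GU K q) :=
  (LinearEquiv.det.comp (GU K q).subtype).ker

variable {K}

theorem smul_mem_isotropicPoints {q : ℕ} (g : GU K q) {P : ℙ K (Fin 3 → K)}
    (hP : P ∈ isotropicPoints K q) :
    (g : (Fin 3 → K) ≃ₗ[K] (Fin 3 → K)) • P ∈ isotropicPoints K q := by
  induction P using Projectivization.ind with
  | h v hv =>
    rw [Projectivization.smul_mk, mk_mem_isotropicPoints]
    rw [mk_mem_isotropicPoints] at hP
    exact (g.2 v v).trans hP

/-- The natural action of the general unitary group on the totally isotropic points. -/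
instance instMulActionGU (q : ℕ) : MulAction (GU K q) (isotropicPoints K q) where
  smul g P := ⟨(g : (Fin 3 → K) ≃ₗ[K] (Fin 3 → K)) • (P : ℙ K (Fin 3 → K)),
    smul_mem_isotropicPoints g P.2⟩
  one_smul P := Subtype.ext (one_smul _ (P : ℙ K (Fin 3 → K)))
  mul_smul g h P := Subtype.ext (mul_smul
    (g : (Fin 3 → K) ≃ₗ[K] (Fin 3 → K)) (h : (Fin 3 → K) ≃ₗ[K] (Fin 3 → K))
    (P : ℙ K (Fin 3 → K)))

variable (K)

/-- `PGU(3,q)` as a permutation group: the group of permutations of the totally isotropic points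
induced by the general unitary group. -/
def PGU (q : ℕ) : Subgroup (Equiv.Perm (isotropicPoints K q)) :=
  (MulAction.toPermHom (GU K q) (isotropicPoints K q)).range

/-- `PSU(3,q)` as a permutation group: the group of permutations of the totally isotropic points
induced by the special unitary group. -/
noncomputable def PSU (q : ℕ) : Subgroup (Equiv.Perm (isotropicPoints K q)) :=
  (SU K q).map (MulAction.toPermHom (GU K q) (isotropicPoints K q))

end Form

section Frobenius

variable (K : Type*) [Field K] (p : ℕ) [Fact p.Prime] [CharP K p]

/-- The semilinear map `(x₁, x₂, x₃) ↦ (x₁^p, x₂^p, x₃^p)` of `K³`. -/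
def frobeniusVec : (Fin 3 → K) →ₛₗ[frobenius K p] (Fin 3 → K) where
  toFun x i := x i ^ p
  map_add' x y := by
    funext i
    exact add_pow_char (x i) (y i) p
  map_smul' a x := by
    funext i
    exact mul_pow a (x i) p

theorem frobeniusVec_injective : Function.Injective (frobeniusVec K p) := by
  intro x y h
  funext i
  exact frobenius_inj K p (congrFun h i)

theorem form_frobeniusVec (q : ℕ) (x y : Fin 3 → K) :
    form q (frobeniusVec K p x) (frobeniusVec K p y) = form q x y ^ p := by
  change x 0 ^ p * (y 2 ^ p) ^ q + x 1 ^ p * (y 1 ^ p) ^ q + x 2 ^ p * (y 0 ^ p) ^ q = _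
  rw [form, add_pow_char, add_pow_char]
  ring

/-- The map `⟨(x₁, x₂, x₃)⟩ ↦ ⟨(x₁^p, x₂^p, x₃^p)⟩` on the totally isotropic points. -/
def frobeniusPoint (q : ℕ) (P : isotropicPoints K q) : isotropicPoints K q :=
  ⟨Projectivization.map (frobeniusVec K p) (frobeniusVec_injective K p) P, by
    obtain ⟨P, hP⟩ := P
    induction P using Projectivization.ind with
    | h v hv =>
      rw [mk_mem_isotropicPoints] at hP
      rw [Projectivization.map_mk, mk_mem_isotropicPoints, form_frobeniusVec, hP,
        zero_pow (Fact.out : p.Prime).ne_zero]⟩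

theorem frobeniusPoint_injective [Finite K] (q : ℕ) :
    Function.Injective (frobeniusPoint K p q) := by
  rintro ⟨P, hP⟩ ⟨Q, hQ⟩ h
  have h' := congrArg Subtype.val h
  apply Subtype.ext
  change P = Q
  change Projectivization.map (frobeniusVec K p) (frobeniusVec_injective K p) P =
    Projectivization.map (frobeniusVec K p) (frobeniusVec_injective K p) Q at h'
  induction P using Projectivization.ind with
  | h v hv =>
    induction Q using Projectivization.ind with
    | h w hw =>
      rw [Projectivization.map_mk, Projectivization.map_mk, Projectivization.mk_eq_mk_iff'] at h'
      obtain ⟨a, ha⟩ := h'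
      obtain ⟨b, rfl⟩ := (frobeniusEquiv K p).surjective a
      rw [Projectivization.mk_eq_mk_iff']
      refine ⟨b, frobeniusVec_injective K p ?_⟩
      rw [map_smulₛₗ]
      exact ha

/-- The permutation of the totally isotropic points induced by the field automorphism `x ↦ x^p`. -/
noncomputable def fieldAut [Finite K] (q : ℕ) : Equiv.Perm (isotropicPoints K q) :=
  Equiv.ofBijective (frobeniusPoint K p q)
    (Finite.injective_iff_bijective.1 (frobeniusPoint_injective K p q))

end Frobenius

end Unitary3

/-! The distance from `v` to `c` is the number of points minus the number of agreements of `v` and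
`c`, so both bounds are about agreements.

Upper bound. The q³ unipotent maps fixing the point o at infinity are sharply transitive on the
other points (`existsUnique_unipotentPerm`). If `v` fixes o, they agree with `v` exactly twice on
average: once at o, and once elsewhere by double counting. Transitivity of PSU reduces every `v` to
this case. For even q the number of points is odd. A `v` moving o then has q³ - 1 agreements with
the family in total, an odd number, so some member agrees with it an odd number of times. If that
number is 1, the quotient has a single fixed point, which can be conjugated to o; the identity is
then below the average 2, so another member is above it.

Lower bound. If h and g in PGU agree at P, the semilinear map g⁻¹h stabilizes P. Two stabilized
points can be moved to ⟨e₁⟩ and ⟨e₃⟩; the map becomes diagonal, and the other stabilized points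
satisfy equations with at most p solutions (`ncard_affinePoints_eigen_le`). So there are at most p +
1 agreements, and g = 1 attains this at points over the prime field. For even q, p = 2 and the
bounds meet. -/

/-- Two permutations agree on as many points as their quotient fixes. -/
theorem permDist_eq_card_sub_ncard_agree {α : Type*} (v c : Equiv.Perm α) :
    permDist v c = Nat.card α - Set.ncard {x : α | v x = c x} := by
  rw [permDist]
  congr 1
  rw [← Set.ncard_image_of_injective {x : α | v x = c x} c.injective]
  congr 1
  ext x
  simp only [Set.mem_ofPred_eq, Set.mem_image, Equiv.Perm.mul_apply]
  constructor
  · intro h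
    exact ⟨c⁻¹ x, by simpa using h, by simp⟩
  · rintro ⟨y, hy, rfl⟩
    simpa using hy

/-! ### Agreements with a sharply transitive family -/

section Agreement

variable {Ω : Type*}

open Classical in
/-- Double counting: a family of permutations that is sharply transitive off `o` agrees with `v`
exactly once at each point off `o` that `v` does not send to `o`. -/
theorem sum_card_agree_of_sharply_transitive [Fintype Ω] (o : Ω) (S : Finset (Equiv.Perm Ω))
    (hreg : ∀ x y, x ≠ o → y ≠ o → ∃! c, c ∈ S ∧ c x = y) (v : Equiv.Perm Ω) :
    ∑ c ∈ S, (Finset.univ.filter fun x => (x ≠ o ∧ v x ≠ o) ∧ v x = c x).card =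
      (Finset.univ.filter fun x => x ≠ o ∧ v x ≠ o).card := by
  have h := Finset.sum_card_bipartiteAbove_eq_sum_card_bipartiteBelow
    (s := S) (t := Finset.univ.filter fun x => x ≠ o ∧ v x ≠ o) (fun c x => v x = c x)
  simp only [Finset.bipartiteAbove, Finset.bipartiteBelow, Finset.filter_filter] at h
  -- Counted by points instead of permutations, each admissible point contributes exactly one `c`.
  rw [h, Finset.card_eq_sum_ones]
  refine Finset.sum_congr rfl fun x hx => ?_
  simp only [Finset.mem_filter, Finset.mem_univ, true_and] at hx
  obtain ⟨c, hc, huniq⟩ := hreg x (v x) hx.1 hx.2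
  rw [Finset.card_eq_one]
  refine ⟨c, ?_⟩
  ext d
  simp only [Finset.mem_filter, Finset.mem_singleton]
  constructor
  · rintro ⟨hd, hdx⟩
    exact huniq d ⟨hd, hdx.symm⟩
  · rintro rfl
    exact ⟨hc.1, hc.2.symm⟩

/-- Evaluation at any one point other than `o` is a bijection from `S` to the points other than `o`.
-/
theorem card_eq_of_sharply_transitive [Fintype Ω] [Nontrivial Ω] [DecidableEq Ω] (o : Ω)
    (S : Finset (Equiv.Perm Ω)) (hfix : ∀ c ∈ S, c o = o)
    (hreg : ∀ x y, x ≠ o → y ≠ o → ∃! c, c ∈ S ∧ c x = y) :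
    S.card = (Finset.univ.filter fun x : Ω => x ≠ o).card := by
  obtain ⟨x, hx⟩ := exists_ne o
  refine Finset.card_bij (fun c _ => c x) ?_ ?_ ?_
  · intro c hc
    simp only [Finset.mem_filter, Finset.mem_univ, true_and]
    intro h
    exact hx (c.injective (h.trans (hfix c hc).symm))
  · intro c hc d hd h
    have hne : c x ≠ o := fun h' => hx (c.injective (h'.trans (hfix c hc).symm))
    exact (hreg x (c x) hx hne).unique ⟨hc, rfl⟩ ⟨hd, h.symm⟩
  · intro y hy
    simp only [Finset.mem_filter, Finset.mem_univ, true_and] at hy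
    obtain ⟨c, hc, -⟩ := hreg x y hx hy
    exact ⟨c, hc.1, hc.2⟩

/-- Every member of `S` agrees with `v` at `o`, and the agreements elsewhere number `S.card` in
total, hence the average 2. -/
theorem sum_card_agree_of_apply_eq [Fintype Ω] [Nontrivial Ω] [DecidableEq Ω] (o : Ω)
    (S : Finset (Equiv.Perm Ω)) (hfix : ∀ c ∈ S, c o = o)
    (hreg : ∀ x y, x ≠ o → y ≠ o → ∃! c, c ∈ S ∧ c x = y) (v : Equiv.Perm Ω) (hv : v o = o) :
    ∑ c ∈ S, (Finset.univ.filter fun x => v x = c x).card = ∑ _c ∈ S, 2 := by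
  have h := sum_card_agree_of_sharply_transitive o S hreg v
  have hvne : ∀ x, x ≠ o → v x ≠ o := fun x hx h' => hx (v.injective (h'.trans hv.symm))
  have hX : (Finset.univ.filter fun x => x ≠ o ∧ v x ≠ o) =
      Finset.univ.filter fun x : Ω => x ≠ o := by
    ext x
    simp only [Finset.mem_filter, Finset.mem_univ, true_and]
    exact ⟨fun h => h.1, fun h => ⟨h, hvne x h⟩⟩
  have hc : ∀ c ∈ S, (Finset.univ.filter fun x => v x = c x).card =
      (Finset.univ.filter fun x => (x ≠ o ∧ v x ≠ o) ∧ v x = c x).card + 1 := by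
    intro c hc
    rw [← Finset.card_insert_of_notMem (a := o) (by simp)]
    congr 1
    ext x
    simp only [Finset.mem_filter, Finset.mem_univ, true_and, Finset.mem_insert]
    constructor
    · intro hx
      by_cases hxo : x = o
      · exact Or.inl hxo
      · exact Or.inr ⟨⟨hxo, hvne x hxo⟩, hx⟩
    · rintro (rfl | hx)
      · rw [hv, hfix c hc]
      · exact hx.2
  rw [Finset.sum_congr rfl hc, Finset.sum_add_distrib]
  have hS := card_eq_of_sharply_transitive o S hfix hreg
  simp only [Finset.sum_const, smul_eq_mul, mul_one]
  have h' : ∑ c ∈ S, (Finset.univ.filter fun x => (x ≠ o ∧ v x ≠ o) ∧ v x = c x).card = S.card := by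
    rw [hS, ← hX]
    convert h
  omega

variable [Finite Ω] [Nontrivial Ω] (G : Subgroup (Equiv.Perm Ω)) (o : Ω) (S : Set (Equiv.Perm Ω))

theorem exists_two_le_ncard_agree (hSG : S ⊆ G) (hfix : ∀ c ∈ S, c o = o)
    (hreg : ∀ x y, x ≠ o → y ≠ o → ∃! c, c ∈ S ∧ c x = y)
    (htrans : ∀ x, ∃ g ∈ G, g x = o) (v : Equiv.Perm Ω) :
    ∃ c ∈ G, 2 ≤ Set.ncard {x | v x = c x} := by
  classical
  have := Fintype.ofFinite Ω
  obtain ⟨g, hg, hgo⟩ := htrans (v o)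
  have hsum := sum_card_agree_of_apply_eq o S.toFinset (by simpa using hfix) (by simpa using hreg)
    (g * v) hgo
  obtain ⟨x, hx⟩ := exists_ne o
  obtain ⟨c₀, hc₀, -⟩ := hreg x x hx hx
  obtain ⟨c, hc, hle⟩ := Finset.exists_le_of_sum_le ⟨c₀, by simpa using hc₀.1⟩ hsum.ge
  refine ⟨g⁻¹ * c, G.mul_mem (G.inv_mem hg) (hSG (by simpa using hc)), hle.trans_eq ?_⟩
  rw [← Set.ncard_coe_finset]
  congr 1
  ext x
  simp only [Finset.coe_filter, Finset.mem_univ, true_and, Set.mem_ofPred_eq]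
  rw [Equiv.Perm.mul_apply, Equiv.Perm.mul_apply, Equiv.Perm.eq_inv_iff_eq]

/-- Parity yields an odd number of agreements with some element of `G`. The only bad case, exactly
one agreement, is settled by averaging, because `1 ∈ S` then falls short of the mean. -/
theorem exists_three_le_ncard_agree (hSG : S ⊆ G) (hone : 1 ∈ S) (hfix : ∀ c ∈ S, c o = o)
    (hreg : ∀ x y, x ≠ o → y ≠ o → ∃! c, c ∈ S ∧ c x = y)
    (htrans : ∀ x, ∃ g ∈ G, g x = o) (hodd : Odd (Nat.card Ω)) (v : Equiv.Perm Ω) :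
    ∃ c ∈ G, 3 ≤ Set.ncard {x | v x = c x} := by
  classical
  have := Fintype.ofFinite Ω
  -- a permutation with exactly one fixed point
  have key : ∀ v : Equiv.Perm Ω, Set.ncard {x | v x = x} = 1 →
      ∃ c ∈ G, 3 ≤ Set.ncard {x | v x = c x} := by
    intro v hv
    obtain ⟨a, ha⟩ := Set.ncard_eq_one.1 hv
    have hva : v a = a := by
      have : a ∈ {x | v x = x} := by rw [ha]; rfl
      exact this
    obtain ⟨g, hg, hgo⟩ := htrans a
    have hga : g⁻¹ o = a := by rw [Equiv.Perm.inv_eq_iff_eq, hgo]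
    -- Conjugation by `g` moves the unique fixed point of `v` to `o`.
    have hsum := sum_card_agree_of_apply_eq o S.toFinset (by simpa using hfix)
      (by simpa using hreg) (g * v * g⁻¹) (by
        rw [Equiv.Perm.mul_apply, Equiv.Perm.mul_apply, hga, hva, hgo])
    have hlt : (Finset.univ.filter fun x => (g * v * g⁻¹) x = (1 : Equiv.Perm Ω) x).card < 2 := by
      refine lt_of_le_of_lt (Finset.card_le_one.2 ?_) one_lt_two
      have huniq : ∀ x, (g * v * g⁻¹) x = x → x = o := by
        intro x hx
        have hx' : v (g⁻¹ x) = g⁻¹ x := by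
          rw [Equiv.Perm.eq_inv_iff_eq]
          exact hx
        have : g⁻¹ x ∈ {x | v x = x} := hx'
        rw [ha, Set.mem_singleton_iff, Equiv.Perm.inv_eq_iff_eq, hgo] at this
        exact this
      intro x hx y hy
      simp only [Finset.mem_filter, Finset.mem_univ, true_and] at hx hy
      rw [huniq x hx, huniq y hy]
    have : ∃ c ∈ S.toFinset, 2 < (Finset.univ.filter fun x => (g * v * g⁻¹) x = c x).card := by
      by_contra! hcon
      exact (Finset.sum_lt_sum hcon ⟨1, by simpa using hone, hlt⟩).ne hsum
    obtain ⟨c, hc, hlt⟩ := this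
    refine ⟨g⁻¹ * c * g, G.mul_mem (G.mul_mem (G.inv_mem hg) (hSG (by simpa using hc))) hg,
      (Nat.succ_le_of_lt hlt).trans_eq ?_⟩
    rw [← Set.ncard_coe_finset, ← Set.ncard_image_of_injective {x | v x = _} g.injective]
    congr 1
    ext x
    simp only [Finset.coe_filter, Finset.mem_univ, true_and, Set.mem_ofPred_eq, Set.mem_image]
    simp only [Equiv.Perm.mul_apply]
    constructor
    · intro h
      exact ⟨g⁻¹ x, by
        rw [Equiv.Perm.eq_inv_iff_eq, h]
        exact congrArg c (g.apply_symm_apply x).symm, g.apply_symm_apply x⟩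
    · rintro ⟨y, hy, rfl⟩
      rw [Equiv.Perm.eq_inv_iff_eq] at hy
      change g (v (g.symm (g y))) = _
      rwa [g.symm_apply_apply]
  -- normalise `v` so that it moves `o`
  obtain ⟨x₁, hx₁⟩ := exists_ne o
  obtain ⟨g, hg, hgv⟩ : ∃ g ∈ G, g (v o) ≠ o := by
    obtain ⟨g, hg, hgo⟩ := htrans (v o)
    obtain ⟨k, hk, hko⟩ := htrans x₁
    -- Since `k` sends `x₁ ≠ o` to `o`, it cannot fix `o`.
    refine ⟨k * g, G.mul_mem hk hg, ?_⟩
    rw [Equiv.Perm.mul_apply, hgo]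
    exact fun h => hx₁ (k.injective (hko.trans h.symm))
  have hsum := sum_card_agree_of_sharply_transitive o S.toFinset (by simpa using hreg) (g * v)
  -- Exactly two points are excluded: `o` and its preimage, distinct because `g * v` moves `o`.
  have hcard : (Finset.univ.filter fun x => x ≠ o ∧ (g * v) x ≠ o).card + 2 = Nat.card Ω := by
    have hne : o ≠ (g * v)⁻¹ o := by
      rw [ne_eq, Equiv.Perm.eq_inv_iff_eq]
      exact hgv
    rw [← Finset.card_pair hne, Nat.card_eq_fintype_card, ← Finset.card_univ,
      ← Finset.card_union_of_disjoint]
    · congr 1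
      ext x
      simp only [Finset.mem_union, Finset.mem_filter, Finset.mem_univ, true_and,
        Finset.mem_insert, Finset.mem_singleton, Equiv.Perm.eq_inv_iff_eq, iff_true]
      tauto
    · rw [Finset.disjoint_left]
      intro x hx
      simp only [Finset.mem_filter, Finset.mem_univ, true_and, Finset.mem_insert,
        Finset.mem_singleton, Equiv.Perm.eq_inv_iff_eq] at hx ⊢
      tauto
  have hex : ∃ c ∈ S.toFinset,
      ¬ Even (Finset.univ.filter fun x => (x ≠ o ∧ (g * v) x ≠ o) ∧ (g * v) x = c x).card := by
    by_contra! hcon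
    have hev := Finset.even_sum _ hcon
    rw [hsum] at hev
    rw [← hcard] at hodd
    exact (Nat.not_even_iff_odd.2 hodd) (hev.add even_two)
  obtain ⟨c, hc, hne⟩ := hex
  have hcS : c ∈ S := by simpa using hc
  have hgc : g⁻¹ * c ∈ G := G.mul_mem (G.inv_mem hg) (hSG hcS)
  -- The excluded points are never agreements: `c` fixes `o` and `g * v` does not.
  have hag : (Finset.univ.filter fun x => (x ≠ o ∧ (g * v) x ≠ o) ∧ (g * v) x = c x).card =
      Set.ncard {x | v x = (g⁻¹ * c) x} := by
    rw [← Set.ncard_coe_finset]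
    congr 1
    ext x
    simp only [Finset.coe_filter, Finset.mem_univ, true_and, Set.mem_ofPred_eq]
    simp only [Equiv.Perm.mul_apply, Equiv.Perm.eq_inv_iff_eq]
    refine ⟨fun h => h.2, fun h => ⟨?_, h⟩⟩
    have hxo : x ≠ o := by
      rintro rfl
      exact hgv (h.trans (hfix c hcS))
    exact ⟨hxo, fun h' => hxo (c.injective ((h.symm.trans h').trans (hfix c hcS).symm))⟩
  rw [hag] at hne
  by_cases h3 : 3 ≤ Set.ncard {x | v x = (g⁻¹ * c) x}
  · exact ⟨_, hgc, h3⟩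
  have h1 : Set.ncard {x | v x = (g⁻¹ * c) x} = 1 := by
    rw [Nat.not_even_iff_odd] at hne
    obtain ⟨k, hk⟩ := hne
    omega
  obtain ⟨d, hd, h3⟩ := key ((g⁻¹ * c)⁻¹ * v) (by
    rw [← h1]
    congr 1
    ext x
    simp only [Set.mem_ofPred_eq, Equiv.Perm.mul_apply _ v, Equiv.Perm.inv_eq_iff_eq])
  refine ⟨(g⁻¹ * c) * d, G.mul_mem hgc hd, h3.trans_eq ?_⟩
  congr 1
  ext x
  simp only [Set.mem_ofPred_eq, Equiv.Perm.mul_apply _ v, Equiv.Perm.mul_apply _ d,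
    Equiv.Perm.inv_eq_iff_eq]

end Agreement

/-! ### From agreement counts to distances and covering radii -/

section CoveringRadius

variable {Ω : Type*}

theorem permDistSet_le_card_sub {C : Set (Equiv.Perm Ω)} {v c : Equiv.Perm Ω} (hc : c ∈ C) {m : ℕ}
    (hm : m ≤ Set.ncard {x | v x = c x}) : permDistSet v C ≤ Nat.card Ω - m := by
  refine (show permDistSet v C ≤ permDist v c from Nat.sInf_le ⟨c, hc, rfl⟩).trans ?_
  rw [permDist_eq_card_sub_ncard_agree]
  omega

/-- Nonemptiness matters: the infimum of the empty set of naturals is 0. -/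
theorem card_sub_le_permDistSet {C : Set (Equiv.Perm Ω)} (hC : C.Nonempty) {v : Equiv.Perm Ω}
    {m : ℕ} (hm : ∀ c ∈ C, Set.ncard {x | v x = c x} ≤ m) : Nat.card Ω - m ≤ permDistSet v C := by
  obtain ⟨c₀, hc₀⟩ := hC
  refine le_csInf ⟨_, c₀, hc₀, rfl⟩ ?_
  rintro d ⟨c, hc, rfl⟩
  rw [permDist_eq_card_sub_ncard_agree]
  have := hm c hc
  omega

theorem permDistSet_anti {C D : Set (Equiv.Perm Ω)} (hC : C.Nonempty) (h : C ⊆ D)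
    (v : Equiv.Perm Ω) : permDistSet v D ≤ permDistSet v C := by
  obtain ⟨c₀, hc₀⟩ := hC
  refine le_csInf ⟨_, c₀, hc₀, rfl⟩ ?_
  rintro d ⟨c, hc, rfl⟩
  exact Nat.sInf_le ⟨c, h hc, rfl⟩

theorem permDistSet_le_coveringRadius [Finite Ω] (C : Set (Equiv.Perm Ω)) (v : Equiv.Perm Ω) :
    permDistSet v C ≤ coveringRadius C :=
  le_csSup (Set.finite_range fun v => permDistSet v C).bddAbove ⟨v, rfl⟩

theorem coveringRadius_le {C : Set (Equiv.Perm Ω)} {m : ℕ} (h : ∀ v, permDistSet v C ≤ m) :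
    coveringRadius C ≤ m := by
  refine csSup_le ⟨_, 1, rfl⟩ ?_
  rintro r ⟨v, rfl⟩
  exact h v

theorem coveringRadius_anti [Finite Ω] {C D : Set (Equiv.Perm Ω)} (hC : C.Nonempty) (h : C ⊆ D) :
    coveringRadius D ≤ coveringRadius C :=
  coveringRadius_le fun v =>
    (permDistSet_anti hC h v).trans (permDistSet_le_coveringRadius C v)

end CoveringRadius

namespace Unitary3

/-! ### Root counts and the trace over the field of order q² -/

section Arithmetic

variable {K : Type*} [Field K]

open Polynomial in
theorem ncard_mul_pow_eq_mul_le {n : ℕ} (hn : 1 < n) {a : K} (ha : a ≠ 0) (c : K) :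
    Set.ncard {x : K | a * x ^ n = c * x} ≤ n := by
  classical
  set P : K[X] := C a * X ^ n - C c * X with hP
  have hcoeff : P.coeff n = a := by
    simp [hP, coeff_X, hn.ne]
  have hP0 : P ≠ 0 := by
    intro h
    rw [h, coeff_zero] at hcoeff
    exact ha hcoeff.symm
  have hdeg : P.natDegree ≤ n := by
    refine (natDegree_sub_le _ _).trans (max_le (natDegree_C_mul_X_pow_le a n) ?_)
    exact ((natDegree_C_mul_le c X).trans natDegree_X_le).trans hn.le
  have hsub : {x : K | a * x ^ n = c * x} ⊆ (P.roots.toFinset : Set K) := by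
    intro x hx
    rw [Finset.mem_coe, Multiset.mem_toFinset, mem_roots hP0, IsRoot, hP]
    simpa [sub_eq_zero] using hx
  refine (Set.ncard_le_ncard hsub (Finset.finite_toSet _)).trans ?_
  rw [Set.ncard_coe_finset]
  exact ((Multiset.toFinset_card_le _).trans (card_roots' P)).trans hdeg

variable {p f q : ℕ} [Fact p.Prime] [CharP K p]

theorem add_pow_q (hq : q = p ^ f) (x y : K) : (x + y) ^ q = x ^ q + y ^ q := by
  rw [hq, add_pow_char_pow]

theorem sub_pow_q (hq : q = p ^ f) (x y : K) : (x - y) ^ q = x ^ q - y ^ q := by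
  rw [hq, sub_pow_char_pow]

theorem q_ne_zero (p : ℕ) [Fact p.Prime] (hq : q = p ^ f) : q ≠ 0 := by
  rw [hq]
  exact pow_ne_zero _ (Fact.out : p.Prime).ne_zero

theorem neg_pow_q (hq : q = p ^ f) (x : K) : (-x) ^ q = -x ^ q := by
  rw [← zero_sub, sub_pow_q hq, zero_pow (q_ne_zero p hq), zero_sub]

theorem pow_q_pow_q [Finite K] (hK : Nat.card K = q ^ 2) (x : K) : (x ^ q) ^ q = x := by
  have := Fintype.ofFinite K
  rw [← pow_mul, ← sq, ← hK, Nat.card_eq_fintype_card, FiniteField.pow_card]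

theorem one_lt_q [Finite K] (hK : Nat.card K = q ^ 2) : 1 < q := by
  have h : 1 < Nat.card K := Finite.one_lt_card
  rw [hK] at h
  exact (Nat.one_lt_pow_iff two_ne_zero).1 h

/-- The trace map `x ↦ x + x^q` from `K` to its subfield of index two. -/
def traceHom (hq : q = p ^ f) : K →+ K where
  toFun x := x + x ^ q
  map_zero' := by rw [zero_pow (q_ne_zero p hq), add_zero]
  map_add' x y := by
    rw [add_pow_q hq]
    ring

/-- Kernel and range both lie in root sets of polynomials of degree q, so each has at most q
elements. Their orders multiply to q², so both equal q. -/
theorem card_ker_traceHom_and_range [Finite K] (hq : q = p ^ f) (hK : Nat.card K = q ^ 2) :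
    Nat.card (traceHom (K := K) hq).ker = q ∧
      ((traceHom (K := K) hq).range : Set K) = {t | t ^ q = t} := by
  have h1q := one_lt_q hK
  have hker : Nat.card (traceHom (K := K) hq).ker ≤ q := by
    refine le_trans ?_ (ncard_mul_pow_eq_mul_le h1q (one_ne_zero (α := K)) (-1))
    refine Set.ncard_le_ncard (s := ((traceHom (K := K) hq).ker : Set K)) (fun x hx => ?_)
      (Set.toFinite _)
    have hx' : x + x ^ q = 0 := hx
    change 1 * x ^ q = -1 * x
    linear_combination hx'
  have hsub : ((traceHom (K := K) hq).range : Set K) ⊆ {t | t ^ q = t} := by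
    rintro _ ⟨x, rfl⟩
    change (x + x ^ q) ^ q = x + x ^ q
    rw [add_pow_q hq, pow_q_pow_q hK, add_comm]
  have hF : Set.ncard {t : K | t ^ q = t} ≤ q := by
    simpa using ncard_mul_pow_eq_mul_le h1q (one_ne_zero (α := K)) 1
  have hrange : Nat.card (traceHom (K := K) hq).range ≤ q :=
    (Set.ncard_le_ncard hsub (Set.toFinite _)).trans hF
  have hmul := AddSubgroup.card_mul_index (traceHom (K := K) hq).ker
  rw [AddSubgroup.index_ker, hK] at hmul
  have hkerq : Nat.card (traceHom (K := K) hq).ker = q := by nlinarith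
  have hrangeq : Nat.card (traceHom (K := K) hq).range = q := by nlinarith
  refine ⟨hkerq, Set.eq_of_subset_of_ncard_le hsub ?_ (Set.toFinite _)⟩
  exact hF.trans_eq hrangeq.symm

theorem card_trace_fiber [Finite K] (hq : q = p ^ f) (hK : Nat.card K = q ^ 2) {t : K}
    (ht : t ^ q = t) : Nat.card {b : K // b + b ^ q = t} = q := by
  obtain ⟨hker, hrange⟩ := card_ker_traceHom_and_range (K := K) hq hK
  obtain ⟨b₀, hb₀⟩ : t ∈ ((traceHom (K := K) hq).range : Set K) := by
    rw [hrange]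
    exact ht
  change b₀ + b₀ ^ q = t at hb₀
  refine (Nat.card_congr ((Equiv.subRight b₀).subtypeEquiv fun b => ?_)).trans hker
  change b + b ^ q = t ↔ (b - b₀) + (b - b₀) ^ q = 0
  rw [sub_pow_q hq, ← sub_eq_zero (a := b + b ^ q), ← hb₀]
  ring_nf

end Arithmetic

/-! ### Affine chart and number of points of the Hermitian curve -/

section Chart

variable {K : Type*} [Field K] {p f q : ℕ}

variable (K) in
/-- The affine part `b + b^q + a a^q = 0` of the Hermitian curve. -/
def affinePoints (q : ℕ) : Set (K × K) := {z | z.1 + z.1 ^ q + z.2 * z.2 ^ q = 0}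

theorem card_affinePoints [Fact p.Prime] [CharP K p] [Finite K] (hq : q = p ^ f)
    (hK : Nat.card K = q ^ 2) : Nat.card (affinePoints K q) = q ^ 3 := by
  have := Fintype.ofFinite K
  let e : affinePoints K q ≃ Σ a : K, {b : K // b + b ^ q = -(a * a ^ q)} :=
    { toFun := fun z => ⟨z.1.2, z.1.1, eq_neg_of_add_eq_zero_left z.2⟩
      invFun := fun w => ⟨(w.2.1, w.1), by
        change w.2.1 + w.2.1 ^ q + w.1 * w.1 ^ q = 0
        rw [w.2.2, neg_add_cancel]⟩
      left_inv := fun _ => rfl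
      right_inv := fun _ => rfl }
  rw [Nat.card_congr e, Nat.card_sigma]
  -- The norm of `a` is fixed by the q-th power map, so each `a` has a trace fibre of q values of
  -- `b`.
  have h : ∀ a : K, Nat.card {b : K // b + b ^ q = -(a * a ^ q)} = q := fun a => by
    refine card_trace_fiber hq hK ?_
    rw [neg_pow_q hq, mul_pow, pow_q_pow_q hK, mul_comm]
  rw [Finset.sum_congr rfl fun a _ => h a, Finset.sum_const, Finset.card_univ,
    ← Nat.card_eq_fintype_card, hK, smul_eq_mul]
  ring

theorem infVec_ne_zero : (![1, 0, 0] : Fin 3 → K) ≠ 0 :=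
  fun h => one_ne_zero (congrFun h 0)

theorem affVec_ne_zero (b a : K) : (![b, a, 1] : Fin 3 → K) ≠ 0 :=
  fun h => one_ne_zero (congrFun h 2)

/-- The point at infinity `⟨(1, 0, 0)⟩` of the Hermitian curve. -/
def infPoint (hq : q ≠ 0) : isotropicPoints K q :=
  ⟨Projectivization.mk K ![1, 0, 0] infVec_ne_zero, by
    rw [mk_mem_isotropicPoints]
    simp [form, hq]⟩

/-- The point `⟨(b, a, 1)⟩` of the Hermitian curve. -/
def affPoint (z : affinePoints K q) : isotropicPoints K q :=
  ⟨Projectivization.mk K ![z.1.1, z.1.2, 1] (affVec_ne_zero _ _), by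
    rw [mk_mem_isotropicPoints]
    have h : z.1.1 + z.1.1 ^ q + z.1.2 * z.1.2 ^ q = 0 := z.2
    simp only [form, Matrix.cons_val, one_pow]
    linear_combination h⟩

theorem affPoint_injective : Function.Injective (affPoint (K := K) (q := q)) := by
  rintro ⟨⟨b, a⟩, hz⟩ ⟨⟨b', a'⟩, hw⟩ h
  have h' := congrArg Subtype.val h
  simp only [affPoint, Projectivization.mk_eq_mk_iff'] at h'
  obtain ⟨c, hc⟩ := h'
  have h0 := congrFun hc 0
  have h1 := congrFun hc 1
  have h2 := congrFun hc 2
  simp only [Pi.smul_apply, Matrix.cons_val, smul_eq_mul, mul_one] at h0 h1 h2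
  subst h2
  simp only [one_mul] at h0 h1
  subst h0 h1
  rfl

theorem affPoint_ne_infPoint (hq : q ≠ 0) (z : affinePoints K q) : affPoint z ≠ infPoint hq := by
  intro h
  have h' := congrArg Subtype.val h
  simp only [affPoint, infPoint, Projectivization.mk_eq_mk_iff'] at h'
  obtain ⟨c, hc⟩ := h'
  have h2 := congrFun hc 2
  simp at h2

theorem eq_infPoint_or_affPoint (hq : q ≠ 0) (P : isotropicPoints K q) :
    P = infPoint hq ∨ ∃ z, P = affPoint z := by
  obtain ⟨P, hP⟩ := P
  induction P using Projectivization.ind with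
  | h v hv =>
    rw [mk_mem_isotropicPoints, form] at hP
    by_cases h2 : v 2 = 0
    · have h1 : v 1 = 0 := by
        simpa [h2, hq] using hP
      left
      apply Subtype.ext
      simp only [infPoint, Projectivization.mk_eq_mk_iff']
      refine ⟨v 0, ?_⟩
      ext i
      fin_cases i <;> simp [h1, h2]
    · right
      refine ⟨⟨((v 2)⁻¹ * v 0, (v 2)⁻¹ * v 1), ?_⟩, ?_⟩
      · change (v 2)⁻¹ * v 0 + ((v 2)⁻¹ * v 0) ^ q + (v 2)⁻¹ * v 1 * ((v 2)⁻¹ * v 1) ^ q = 0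
        rw [mul_pow, mul_pow, inv_pow]
        have h2q : v 2 ^ q ≠ 0 := pow_ne_zero _ h2
        field_simp
        linear_combination hP
      · apply Subtype.ext
        simp only [affPoint, Projectivization.mk_eq_mk_iff']
        refine ⟨v 2, ?_⟩
        ext i
        fin_cases i <;> simp [h2]

theorem exists_eq_affPoint {hq : q ≠ 0} {P : isotropicPoints K q} (hP : P ≠ infPoint hq) :
    ∃ z, P = affPoint z :=
  (eq_infPoint_or_affPoint hq P).resolve_left hP

theorem card_isotropicPoints [Fact p.Prime] [CharP K p] [Finite K] (hq : q = p ^ f)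
    (hK : Nat.card K = q ^ 2) : Nat.card (isotropicPoints K q) = q ^ 3 + 1 := by
  have hq0 := q_ne_zero p hq
  let φ : Option (affinePoints K q) → isotropicPoints K q := fun z => z.elim (infPoint hq0) affPoint
  have hφ : Function.Bijective φ := by
    constructor
    · rintro (_ | z) (_ | w) h
      · rfl
      · exact absurd h.symm (affPoint_ne_infPoint hq0 w)
      · exact absurd h (affPoint_ne_infPoint hq0 z)
      · exact congrArg some (affPoint_injective h)
    · intro P
      rcases eq_infPoint_or_affPoint hq0 P with rfl | ⟨z, rfl⟩
      · exact ⟨none, rfl⟩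
      · exact ⟨some z, rfl⟩
  rw [← Nat.card_congr (Equiv.ofBijective φ hφ), Finite.card_option, card_affinePoints hq hK]

end Chart

end Unitary3

namespace Unitary3

/-! ### Unipotent and Weyl elements; transitivity -/

section Unipotent

variable {K : Type*} [Field K] {p f q : ℕ}

/-- The linear map `(x₁, x₂, x₃) ↦ (x₁ - a^q x₂ + b x₃, x₂ + a x₃, x₃)`. -/
def unipotent (q : ℕ) (z : K × K) : (Fin 3 → K) ≃ₗ[K] (Fin 3 → K) where
  toFun x := ![x 0 - z.2 ^ q * x 1 + z.1 * x 2, x 1 + z.2 * x 2, x 2]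
  map_add' x y := by
    ext i
    fin_cases i <;> simp <;> ring
  map_smul' c x := by
    ext i
    fin_cases i <;> simp <;> ring
  invFun x := ![x 0 + z.2 ^ q * (x 1 - z.2 * x 2) - z.1 * x 2, x 1 - z.2 * x 2, x 2]
  left_inv x := by
    ext i
    fin_cases i <;> simp
    ring
  right_inv x := by
    ext i
    fin_cases i <;> simp
    ring

theorem unipotent_apply (z : K × K) (x : Fin 3 → K) :
    unipotent q z x = ![x 0 - z.2 ^ q * x 1 + z.1 * x 2, x 1 + z.2 * x 2, x 2] := rfl

theorem det_unipotent (z : K × K) : LinearEquiv.det (unipotent q z) = 1 := by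
  ext
  rw [LinearEquiv.coe_det]
  have h : ((unipotent q z : (Fin 3 → K) ≃ₗ[K] (Fin 3 → K)) : (Fin 3 → K) →ₗ[K] (Fin 3 → K)) =
      Matrix.toLin' !![1, -z.2 ^ q, z.1; 0, 1, z.2; 0, 0, 1] := by
    refine LinearMap.ext fun x => ?_
    rw [LinearEquiv.coe_coe, unipotent_apply, Matrix.toLin'_apply]
    ext i
    fin_cases i <;> simp [Matrix.mulVec, dotProduct, Fin.sum_univ_three]
    ring
  rw [h, LinearMap.det_toLin', Matrix.det_fin_three]
  simp

/-- The linear map `(x₁, x₂, x₃) ↦ (x₃, -x₂, x₁)`. -/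
def weyl (K : Type*) [Field K] : (Fin 3 → K) ≃ₗ[K] (Fin 3 → K) where
  toFun x := ![x 2, -x 1, x 0]
  map_add' x y := by
    ext i
    fin_cases i <;> simp
    ring
  map_smul' c x := by
    ext i
    fin_cases i <;> simp
  invFun x := ![x 2, -x 1, x 0]
  left_inv x := by
    ext i
    fin_cases i <;> simp
  right_inv x := by
    ext i
    fin_cases i <;> simp

theorem weyl_apply (x : Fin 3 → K) : weyl K x = ![x 2, -x 1, x 0] := rfl

theorem det_weyl : LinearEquiv.det (weyl K) = 1 := by
  ext
  rw [LinearEquiv.coe_det]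
  have h : ((weyl K : (Fin 3 → K) ≃ₗ[K] (Fin 3 → K)) : (Fin 3 → K) →ₗ[K] (Fin 3 → K)) =
      Matrix.toLin' !![0, 0, 1; 0, -1, 0; 1, 0, 0] := by
    refine LinearMap.ext fun x => ?_
    rw [LinearEquiv.coe_coe, weyl_apply, Matrix.toLin'_apply]
    ext i
    fin_cases i <;> simp [Matrix.mulVec, dotProduct, Fin.sum_univ_three]
  rw [h, LinearMap.det_toLin', Matrix.det_fin_three]
  simp

/-- The permutation of the isotropic points induced by an element of the unitary group. -/
abbrev pointPerm (g : GU K q) : Equiv.Perm (isotropicPoints K q) :=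
  MulAction.toPermHom (GU K q) (isotropicPoints K q) g

theorem PSU_le_PGU : PSU K q ≤ PGU K q := by
  rintro _ ⟨g, -, rfl⟩
  exact ⟨g, rfl⟩

variable [Fact p.Prime] [CharP K p]

theorem weyl_mem_GU (hq : q = p ^ f) : weyl K ∈ GU K q := by
  intro x y
  simp only [form, weyl_apply, Matrix.cons_val, neg_pow_q hq]
  ring

theorem pointPerm_weyl_affPoint_zero (hq : q = p ^ f) :
    ∃ z : affinePoints K q, z.1 = 0 ∧
      pointPerm ⟨weyl K, weyl_mem_GU hq⟩ (affPoint z) = infPoint (q_ne_zero p hq) := by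
  have hq0 := q_ne_zero p hq
  refine ⟨⟨0, by simp [affinePoints, hq0]⟩, rfl, Subtype.ext ?_⟩
  change weyl K • Projectivization.mk K _ _ = Projectivization.mk K _ _
  rw [Projectivization.smul_mk]
  congr 1
  change weyl K _ = _
  rw [weyl_apply]
  simp

variable [Finite K]

theorem unipotent_mem_GU (hq : q = p ^ f) (hK : Nat.card K = q ^ 2) {z : K × K}
    (hz : z ∈ affinePoints K q) : unipotent q z ∈ GU K q := by
  intro x y
  have hz' : z.1 + z.1 ^ q + z.2 * z.2 ^ q = 0 := hz
  simp only [form, unipotent_apply, Matrix.cons_val, add_pow_q hq, sub_pow_q hq, mul_pow,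
    pow_q_pow_q hK]
  linear_combination x 2 * y 2 ^ q * hz'

/-- The permutation of the isotropic points induced by a unipotent map fixing the point at
infinity. -/
def unipotentPerm (hq : q = p ^ f) (hK : Nat.card K = q ^ 2) (z : affinePoints K q) :
    Equiv.Perm (isotropicPoints K q) :=
  pointPerm ⟨unipotent q z.1, unipotent_mem_GU hq hK z.2⟩

theorem unipotentPerm_mem_PSU (hq : q = p ^ f) (hK : Nat.card K = q ^ 2)
    (z : affinePoints K q) : unipotentPerm hq hK z ∈ PSU K q :=
  Subgroup.mem_map.2 ⟨_, det_unipotent z.1, rfl⟩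

theorem unipotentPerm_infPoint (hq : q = p ^ f) (hK : Nat.card K = q ^ 2)
    (z : affinePoints K q) :
    unipotentPerm hq hK z (infPoint (q_ne_zero p hq)) = infPoint (q_ne_zero p hq) := by
  refine Subtype.ext ?_
  change unipotent q z.1 • Projectivization.mk K _ _ = Projectivization.mk K _ _
  rw [Projectivization.smul_mk]
  congr 1
  change unipotent q z.1 _ = _
  rw [unipotent_apply]
  simp

theorem unipotentPerm_affPoint (hq : q = p ^ f) (hK : Nat.card K = q ^ 2)
    (z w u : affinePoints K q) (h1 : w.1.1 - z.1.2 ^ q * w.1.2 + z.1.1 = u.1.1)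
    (h2 : w.1.2 + z.1.2 = u.1.2) : unipotentPerm hq hK z (affPoint w) = affPoint u := by
  refine Subtype.ext ?_
  change unipotent q z.1 • Projectivization.mk K _ _ = Projectivization.mk K _ _
  rw [Projectivization.smul_mk]
  congr 1
  change unipotent q z.1 _ = _
  rw [unipotent_apply, ← h1, ← h2]
  simp

theorem unipotentPerm_zero (hq : q = p ^ f) (hK : Nat.card K = q ^ 2) :
    1 ∈ Set.range (unipotentPerm (K := K) hq hK) := by
  have hq0 := q_ne_zero p hq
  refine ⟨⟨0, by simp [affinePoints, hq0]⟩, Equiv.ext fun P => ?_⟩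
  rcases eq_infPoint_or_affPoint hq0 P with rfl | ⟨w, rfl⟩
  · exact unipotentPerm_infPoint hq hK _
  · exact unipotentPerm_affPoint hq hK _ w w (by simp [hq0]) (by simp)

theorem existsUnique_unipotentPerm (hq : q = p ^ f) (hK : Nat.card K = q ^ 2)
    (P Q : isotropicPoints K q) (hP : P ≠ infPoint (q_ne_zero p hq))
    (hQ : Q ≠ infPoint (q_ne_zero p hq)) :
    ∃! c, c ∈ Set.range (unipotentPerm (K := K) hq hK) ∧ c P = Q := by
  obtain ⟨x, rfl⟩ := exists_eq_affPoint hP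
  obtain ⟨y, rfl⟩ := exists_eq_affPoint hQ
  have hmem : ∀ z w : affinePoints K q,
      (w.1.1 - z.1.2 ^ q * w.1.2 + z.1.1, w.1.2 + z.1.2) ∈ affinePoints K q := by
    intro z w
    have hz : z.1.1 + z.1.1 ^ q + z.1.2 * z.1.2 ^ q = 0 := z.2
    have hw : w.1.1 + w.1.1 ^ q + w.1.2 * w.1.2 ^ q = 0 := w.2
    simp only [affinePoints, Set.mem_ofPred_eq, add_pow_q hq, sub_pow_q hq, mul_pow,
      pow_q_pow_q hK]
    linear_combination hz + hw
  have hx : x.1.1 + x.1.1 ^ q + x.1.2 * x.1.2 ^ q = 0 := x.2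
  have hy : y.1.1 + y.1.1 ^ q + y.1.2 * y.1.2 ^ q = 0 := y.2
  -- Solves the two equations of `unipotentPerm_affPoint`: the second gives `z.2`, then the first
  -- gives `z.1`.
  let z₀ : affinePoints K q :=
    ⟨(y.1.1 - x.1.1 + (y.1.2 - x.1.2) ^ q * x.1.2, y.1.2 - x.1.2), by
      simp only [affinePoints, Set.mem_ofPred_eq, add_pow_q hq, sub_pow_q hq, mul_pow,
        pow_q_pow_q hK]
      linear_combination hy - hx⟩
  refine ⟨unipotentPerm hq hK z₀, ⟨⟨z₀, rfl⟩, ?_⟩, ?_⟩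
  · refine unipotentPerm_affPoint hq hK z₀ x y ?_ ?_ <;> simp only [z₀] <;> ring
  · rintro _ ⟨⟨z, rfl⟩, hz⟩
    rw [unipotentPerm_affPoint hq hK z x ⟨_, hmem z x⟩ rfl rfl] at hz
    have h := affPoint_injective hz
    congr 1
    have h2 : x.1.2 + z.1.2 = y.1.2 := congrArg (fun u => u.1.2) h
    have h1 : x.1.1 - z.1.2 ^ q * x.1.2 + z.1.1 = y.1.1 := congrArg (fun u => u.1.1) h
    refine Subtype.ext (Prod.ext ?_ ?_)
    · simp only [z₀]
      rw [← h1, ← h2, add_sub_cancel_left]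
      ring
    · simp only [z₀]
      rw [← h2, add_sub_cancel_left]

/-- A unipotent map carries an affine point to the origin, and the Weyl element carries the origin
to infinity. -/
theorem exists_mem_PSU_apply_eq_infPoint (hq : q = p ^ f) (hK : Nat.card K = q ^ 2)
    (P : isotropicPoints K q) : ∃ g ∈ PSU K q, g P = infPoint (q_ne_zero p hq) := by
  by_cases hP : P = infPoint (q_ne_zero p hq)
  · exact ⟨1, one_mem _, hP⟩
  obtain ⟨z, -, hz⟩ := pointPerm_weyl_affPoint_zero (K := K) hq
  obtain ⟨c, ⟨⟨y, rfl⟩, hc⟩, -⟩ := existsUnique_unipotentPerm hq hK P (affPoint z) hP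
    (affPoint_ne_infPoint _ z)
  refine ⟨_, mul_mem (Subgroup.mem_map.2 ⟨⟨weyl K, weyl_mem_GU hq⟩, det_weyl, rfl⟩) (unipotentPerm_mem_PSU hq hK y), ?_⟩
  exact (congrArg _ hc).trans hz

/-- The unitary group is doubly transitive on the isotropic points. -/
theorem exists_pointPerm_apply_eq_and_eq (hq : q = p ^ f) (hK : Nat.card K = q ^ 2)
    {P Q : isotropicPoints K q} (hPQ : P ≠ Q) (z : affinePoints K q) :
    ∃ g : GU K q, pointPerm g P = infPoint (q_ne_zero p hq) ∧ pointPerm g Q = affPoint z := by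
  obtain ⟨_, ⟨g, -, rfl⟩, hg⟩ := exists_mem_PSU_apply_eq_infPoint hq hK P
  have hQ : pointPerm g Q ≠ infPoint (q_ne_zero p hq) := fun h =>
    hPQ ((pointPerm g).injective (hg.trans h.symm))
  obtain ⟨c, ⟨⟨y, rfl⟩, hc⟩, -⟩ := existsUnique_unipotentPerm hq hK _ (affPoint z) hQ
    (affPoint_ne_infPoint _ z)
  refine ⟨⟨unipotent q y.1, unipotent_mem_GU hq hK y.2⟩ * g, ?_, ?_⟩
  · rw [pointPerm, map_mul]
    exact (congrArg _ hg).trans (unipotentPerm_infPoint hq hK y)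
  · rw [pointPerm, map_mul]
    exact hc

end Unipotent

end Unitary3

namespace Unitary3

/-! ### Points stabilized by Frobenius-semilinear maps -/

section Semilinear

variable {K : Type*} [Field K] {p f q : ℕ}

/-- On the solutions of `a x^p = c x` the map `x ↦ x^(p^k)` is multiplication by a constant. -/
theorem exists_pow_eq_mul_of_mul_pow_eq_mul {a : K} (ha : a ≠ 0) (c : K) (k : ℕ) :
    ∃ N : K, ∀ x : K, a * x ^ p = c * x → x ^ p ^ k = N * x := by
  induction k with
  | zero => exact ⟨1, fun x _ => by simp⟩
  | succ k ih =>
    obtain ⟨N, hN⟩ := ih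
    refine ⟨N ^ p * (a⁻¹ * c), fun x hx => ?_⟩
    rw [pow_succ, pow_mul, hN x hx, mul_pow]
    have : x ^ p = a⁻¹ * (c * x) := by
      rw [← hx, inv_mul_cancel_left₀ ha]
    rw [this]
    ring

/-- On the solutions of the first equation x^q = N x, so the curve reads (1 + N) x + y y^q = 0. If N
= -1 then y = 0 and x determines the point; otherwise y determines x. Either coordinate takes at
most p values. -/
theorem ncard_affinePoints_eigen_le [Fact p.Prime] [Finite K] (hq : q = p ^ f) {a b : K} (ha : a ≠ 0) (hb : b ≠ 0) (c : K) :
    Set.ncard {z : affinePoints K q | a * z.1.1 ^ p = c * z.1.1 ∧ b * z.1.2 ^ p = c * z.1.2} ≤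
      p := by
  have hp := (Fact.out : p.Prime).one_lt
  have hq0 := q_ne_zero p hq
  obtain ⟨N, hN⟩ := exists_pow_eq_mul_of_mul_pow_eq_mul (p := p) ha c f
  rw [← hq] at hN
  by_cases hN1 : 1 + N = 0
  · have hz2 : ∀ z : affinePoints K q, a * z.1.1 ^ p = c * z.1.1 → z.1.2 = 0 := by
      intro z hz
      have h : z.1.1 + z.1.1 ^ q + z.1.2 * z.1.2 ^ q = 0 := z.2
      rw [hN _ hz, ← one_add_mul, hN1, zero_mul, zero_add] at h
      rcases mul_eq_zero.1 h with h | h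
      · exact h
      · exact eq_zero_of_pow_eq_zero h
    refine le_trans (Set.ncard_le_ncard_of_injOn (fun z => z.1.1) (fun z hz => hz.1) ?_
      (Set.toFinite _)) (ncard_mul_pow_eq_mul_le hp ha c)
    intro z hz w hw h
    exact Subtype.ext (Prod.ext h ((hz2 z hz.1).trans (hz2 w hw.1).symm))
  · refine le_trans (Set.ncard_le_ncard_of_injOn (fun z => z.1.2) (fun z hz => hz.2) ?_
      (Set.toFinite _)) (ncard_mul_pow_eq_mul_le hp hb c)
    intro z hz w hw h
    have hz' : z.1.1 + z.1.1 ^ q + z.1.2 * z.1.2 ^ q = 0 := z.2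
    have hw' : w.1.1 + w.1.1 ^ q + w.1.2 * w.1.2 ^ q = 0 := w.2
    have h2 : z.1.2 = w.1.2 := h
    rw [hN _ hz.1, h2] at hz'
    rw [hN _ hw.1] at hw'
    refine Subtype.ext (Prod.ext (mul_left_cancel₀ hN1 ?_) h2)
    linear_combination hz' - hw'

variable [Fact p.Prime] [CharP K p]

/-- The point `P` is mapped into itself by the semilinear map `σ`. -/
def Stabilizes (σ : (Fin 3 → K) →ₛₗ[frobenius K p] (Fin 3 → K)) (P : ℙ K (Fin 3 → K)) : Prop :=
  ∀ x ∈ P.submodule, σ x ∈ P.submodule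

theorem stabilizes_mk {σ : (Fin 3 → K) →ₛₗ[frobenius K p] (Fin 3 → K)} {v : Fin 3 → K}
    (hv : v ≠ 0) : Stabilizes σ (Projectivization.mk K v hv) ↔ ∃ a : K, a • v = σ v := by
  simp only [Stabilizes, Projectivization.submodule_mk]
  constructor
  · intro h
    exact Submodule.mem_span_singleton.1 (h v (Submodule.mem_span_singleton_self v))
  · rintro ⟨a, ha⟩ x hx
    obtain ⟨b, rfl⟩ := Submodule.mem_span_singleton.1 hx
    rw [map_smulₛₗ, ← ha]
    exact Submodule.smul_mem _ _ (Submodule.smul_mem _ _ (Submodule.mem_span_singleton_self v))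

/-- Over the prime field the curve is 2x + y² = 0. It contains (t, 0) in characteristic 2 and (-2t²,
2t) otherwise. -/
theorem exists_injective_affinePoints_pow_eq (hq : q = p ^ f) :
    ∃ φ : Fin p → affinePoints K q, Function.Injective φ ∧
      ∀ t, (φ t).1.1 ^ p = (φ t).1.1 ∧ (φ t).1.2 ^ p = (φ t).1.2 := by
  have hcast : Function.Injective fun t : Fin p => ((t : ℕ) : K) := fun s t h =>
    Fin.ext (CharP.natCast_injOn_Iio K p s.2 t.2 h)
  have hpow : ∀ n : ℕ, (n : K) ^ p = n := fun n => map_natCast (frobenius K p) n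
  have hpowq : ∀ n : ℕ, (n : K) ^ q = n := fun n => by
    rw [hq]
    exact map_natCast (iterateFrobenius K p f) n
  by_cases hp : p = 2
  · have h2 : (2 : K) = 0 := by
      rw [← Nat.cast_ofNat, ← hp]
      exact CharP.cast_eq_zero K p
    refine ⟨fun t => ⟨((t : ℕ), 0), ?_⟩, fun s t h => hcast (congrArg (fun z => z.1.1) h),
      fun t => ⟨hpow _, zero_pow (Fact.out : p.Prime).ne_zero⟩⟩
    simp only [affinePoints, Set.mem_ofPred_eq, hpowq, zero_mul, add_zero]
    linear_combination (t : K) * h2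
  · have h2 : (2 : K) ≠ 0 := by
      rw [← Nat.cast_ofNat, ne_eq, CharP.cast_eq_zero_iff K p]
      exact fun h => hp ((Nat.prime_dvd_prime_iff_eq Fact.out Nat.prime_two).1 h)
    have hneg : ∀ x : K, (-x) ^ p = -x ^ p := fun x => map_neg (frobenius K p) x
    refine ⟨fun t => ⟨(-((2 * (t : ℕ) ^ 2 : ℕ) : K), ((2 * (t : ℕ) : ℕ) : K)), ?_⟩, ?_, ?_⟩
    · simp only [affinePoints, Set.mem_ofPred_eq, neg_pow_q hq, hpowq]
      push_cast
      ring
    · intro s t h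
      have h' : ((2 * (s : ℕ) : ℕ) : K) = ((2 * (t : ℕ) : ℕ) : K) :=
        congrArg (fun z => z.1.2) h
      push_cast at h'
      exact hcast (mul_left_cancel₀ h2 h')
    · exact fun t => ⟨by rw [hneg, hpow], hpow _⟩

variable [Finite K]

theorem ncard_stabilizes_le_of_standard (hq : q = p ^ f)
    {σ : (Fin 3 → K) →ₛₗ[frobenius K p] (Fin 3 → K)}
    (hσ : ∀ x y, form q (σ x) (σ y) = form q x y ^ p) {z₀ : affinePoints K q} (hz₀ : z₀.1 = 0)
    (hinf : Stabilizes σ (infPoint (K := K) (q_ne_zero p hq)).1)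
    (hzero : Stabilizes σ (affPoint z₀).1) :
    Set.ncard {P : isotropicPoints K q | Stabilizes σ P.1} ≤ p + 1 := by
  have hp0 := (Fact.out : p.Prime).ne_zero
  have hq0 := q_ne_zero p hq
  obtain ⟨a, ha⟩ := (stabilizes_mk _).1 hinf
  obtain ⟨c, hc⟩ := (stabilizes_mk _).1 hzero
  have hz1 : z₀.1.1 = 0 := by rw [hz₀]; rfl
  have hz2 : z₀.1.2 = 0 := by rw [hz₀]; rfl
  rw [hz1, hz2] at hc
  -- The image of e₂ is orthogonal to those of e₁ and e₃, which are nonzero multiples of e₁ and e₃.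
  -- Hence it is a multiple of e₂, and `σ` is diagonal.
  have hac := hσ ![1, 0, 0] ![0, 0, 1]
  have h21 := hσ ![0, 1, 0] ![1, 0, 0]
  have h23 := hσ ![0, 1, 0] ![0, 0, 1]
  have h22 := hσ ![0, 1, 0] ![0, 1, 0]
  rw [← ha] at hac h21
  rw [← hc] at hac h23
  simp only [form, Pi.smul_apply, Matrix.cons_val, smul_eq_mul, mul_one, mul_zero, one_pow,
    zero_pow hq0, zero_pow hp0, add_zero, zero_add] at hac h21 h23 h22
  have ha0 : a ≠ 0 := left_ne_zero_of_mul_eq_one hac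
  have hcq : c ^ q ≠ 0 := right_ne_zero_of_mul_eq_one hac
  replace h21 := (mul_eq_zero.1 h21).resolve_right (pow_ne_zero _ ha0)
  replace h23 := (mul_eq_zero.1 h23).resolve_right hcq
  rw [h21, h23, zero_mul, zero_add, add_zero] at h22
  have hb0 := left_ne_zero_of_mul_eq_one h22
  have happly : ∀ x y : K,
      σ ![x, y, 1] = ![a * x ^ p, σ ![0, 1, 0] 1 * y ^ p, c] := by
    intro x y
    have hdec : (![x, y, 1] : Fin 3 → K) = x • ![1, 0, 0] + y • ![0, 1, 0] + ![0, 0, 1] := by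
      ext i
      fin_cases i <;> simp
    rw [hdec, map_add, map_add, map_smulₛₗ, map_smulₛₗ, ← ha, ← hc, frobenius_def, frobenius_def]
    ext i
    simp only [Pi.add_apply, Pi.smul_apply]
    fin_cases i <;> simp [h21, h23, mul_comm]
  have hsub : {P : isotropicPoints K q | Stabilizes σ P.1} ⊆ insert (infPoint hq0)
      (affPoint '' {z : affinePoints K q |
        a * z.1.1 ^ p = c * z.1.1 ∧ σ ![0, 1, 0] 1 * z.1.2 ^ p = c * z.1.2}) := by
    intro P hP
    rcases eq_infPoint_or_affPoint hq0 P with rfl | ⟨z, rfl⟩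
    · exact Set.mem_insert _ _
    · refine Set.mem_insert_of_mem _ ⟨z, ?_, rfl⟩
      obtain ⟨d, hd⟩ := (stabilizes_mk _).1 hP
      rw [happly] at hd
      have h0 := congrFun hd 0
      have h1 := congrFun hd 1
      have h2 := congrFun hd 2
      simp only [Pi.smul_apply, Matrix.cons_val, smul_eq_mul, mul_one] at h0 h1 h2
      subst h2
      exact ⟨h0.symm, h1.symm⟩
  refine (Set.ncard_le_ncard hsub (Set.toFinite _)).trans ((Set.ncard_insert_le _ _).trans ?_)
  exact Nat.succ_le_succ ((Set.ncard_image_le (Set.toFinite _)).trans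
    (ncard_affinePoints_eigen_le hq ha0 hb0 c))

/-- A semilinear map of the unitary space whose field automorphism is `x ↦ x^p` stabilizes at most
`p + 1` isotropic points. -/
theorem ncard_stabilizes_le (hq : q = p ^ f) (hK : Nat.card K = q ^ 2)
    {σ : (Fin 3 → K) →ₛₗ[frobenius K p] (Fin 3 → K)}
    (hσ : ∀ x y, form q (σ x) (σ y) = form q x y ^ p) :
    Set.ncard {P : isotropicPoints K q | Stabilizes σ P.1} ≤ p + 1 := by
  by_cases hsmall : Set.ncard {P : isotropicPoints K q | Stabilizes σ P.1} ≤ 1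
  · omega
  have hq0 := q_ne_zero p hq
  obtain ⟨P, hP, Q, hQ, hPQ⟩ := Set.one_lt_ncard_iff_nontrivial.1 (not_le.1 hsmall)
  obtain ⟨z₀, hz₀⟩ : ∃ z₀ : affinePoints K q, z₀.1 = 0 :=
    ⟨⟨0, by simp [affinePoints, hq0]⟩, rfl⟩
  obtain ⟨g, hgP, hgQ⟩ := exists_pointPerm_apply_eq_and_eq hq hK hPQ z₀
  -- Double transitivity allows conjugating `σ` so that two stabilized points become infinity and
  -- the origin.
  let γ : (Fin 3 → K) ≃ₗ[K] (Fin 3 → K) := g.1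
  let τ : (Fin 3 → K) →ₛₗ[frobenius K p] (Fin 3 → K) :=
    (γ : (Fin 3 → K) →ₗ[K] (Fin 3 → K)).comp
      (σ.comp (γ.symm : (Fin 3 → K) →ₗ[K] (Fin 3 → K)))
  have hτ : ∀ x y, form q (τ x) (τ y) = form q x y ^ p := by
    intro x y
    have h1 : form q (τ x) (τ y) = form q (σ (γ.symm x)) (σ (γ.symm y)) := g.2 _ _
    have h2 : form q (γ.symm x) (γ.symm y) = form q x y := (g⁻¹).2 x y
    rw [h1, hσ, h2]
  have hstab : ∀ R : isotropicPoints K q, Stabilizes σ R.1 → Stabilizes τ (pointPerm g R).1 := by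
    rintro ⟨R, hRiso⟩ hR
    induction R using Projectivization.ind with
    | h v hv =>
      obtain ⟨a, ha⟩ := (stabilizes_mk hv).1 hR
      have hγv : γ v ≠ 0 := by simpa using hv
      change Stabilizes τ (γ • Projectivization.mk K v hv)
      rw [Projectivization.smul_mk]
      refine (stabilizes_mk hγv).2 ⟨a, ?_⟩
      change a • γ v = γ (σ (γ.symm (γ v)))
      rw [γ.symm_apply_apply, ← ha, map_smul]
  refine le_trans (Set.ncard_le_ncard_of_injOn (pointPerm g) (fun R hR => hstab R hR)
    (pointPerm g).injective.injOn (Set.toFinite _))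
    (ncard_stabilizes_le_of_standard hq hτ hz₀ ?_ ?_)
  · rw [← hgP]
    exact hstab P hP
  · rw [← hgQ]
    exact hstab Q hQ

/-- At an agreement with g, the map g⁻¹h stabilizes the point; it is semilinear and raises form
values to the p-th power. -/
theorem ncard_fieldAut_agree_le (hq : q = p ^ f) (hK : Nat.card K = q ^ 2)
    {c : Equiv.Perm (isotropicPoints K q)} (hc : c ∈ PGU K q) :
    Set.ncard {P | fieldAut K p q P = c P} ≤ p + 1 := by
  obtain ⟨g, rfl⟩ := hc
  let γ : (Fin 3 → K) ≃ₗ[K] (Fin 3 → K) := g.1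
  let σ : (Fin 3 → K) →ₛₗ[frobenius K p] (Fin 3 → K) :=
    (γ.symm : (Fin 3 → K) →ₗ[K] (Fin 3 → K)).comp (frobeniusVec K p)
  have hσ : ∀ x y, form q (σ x) (σ y) = form q x y ^ p := by
    intro x y
    have h1 : form q (σ x) (σ y) = form q (frobeniusVec K p x) (frobeniusVec K p y) :=
      (g⁻¹).2 _ _
    rw [h1, form_frobeniusVec]
  refine le_trans (Set.ncard_le_ncard ?_ (Set.toFinite _)) (ncard_stabilizes_le hq hK hσ)
  rintro ⟨P, hPiso⟩ hP
  induction P using Projectivization.ind with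
  | h v hv =>
    have h := congrArg Subtype.val (show fieldAut K p q _ = pointPerm g _ from hP)
    change Projectivization.map (frobeniusVec K p) (frobeniusVec_injective K p)
      (Projectivization.mk K v hv) = γ • Projectivization.mk K v hv at h
    rw [Projectivization.map_mk, Projectivization.smul_mk, Projectivization.mk_eq_mk_iff'] at h
    obtain ⟨a, ha⟩ := h
    refine (stabilizes_mk hv).2 ⟨a, ?_⟩
    change a • v = γ.symm (frobeniusVec K p v)
    rw [← ha, LinearEquiv.eq_symm_apply, map_smul]
    rfl

theorem le_ncard_fieldAut_fixed (hq : q = p ^ f) :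
    p + 1 ≤ Set.ncard {P | fieldAut K p q P = (1 : Equiv.Perm (isotropicPoints K q)) P} := by
  have hp0 := (Fact.out : p.Prime).ne_zero
  have hq0 := q_ne_zero p hq
  obtain ⟨φ, hφ, hpow⟩ := exists_injective_affinePoints_pow_eq (K := K) hq
  have hcard : Set.ncard (insert (infPoint hq0) (Set.range fun t => affPoint (φ t))) = p + 1 := by
    rw [Set.ncard_insert_of_notMem]
    · rw [← Set.image_univ,
        Set.ncard_image_of_injective _ (f := fun t => affPoint (φ t)) (affPoint_injective.comp hφ),
        Set.ncard_univ, Nat.card_eq_fintype_card, Fintype.card_fin]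
    · rintro ⟨t, ht⟩
      exact affPoint_ne_infPoint hq0 _ ht
  rw [← hcard]
  refine Set.ncard_le_ncard ?_ (Set.toFinite _)
  rintro _ (rfl | ⟨t, rfl⟩)
  · refine Subtype.ext ?_
    change Projectivization.map (frobeniusVec K p) (frobeniusVec_injective K p)
      (Projectivization.mk K _ _) = Projectivization.mk K _ _
    rw [Projectivization.map_mk]
    congr 1
    ext i
    fin_cases i <;> simp [frobeniusVec, hp0]
  · refine Subtype.ext ?_
    change Projectivization.map (frobeniusVec K p) (frobeniusVec_injective K p)
      (Projectivization.mk K _ _) = Projectivization.mk K _ _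
    rw [Projectivization.map_mk]
    congr 1
    ext i
    fin_cases i <;> simp [frobeniusVec, hpow t]

/-! ### The exact distance of h and the upper bound -/

theorem permDistSet_fieldAut (hq : q = p ^ f) (hK : Nat.card K = q ^ 2) :
    permDistSet (fieldAut K p q) (PGU K q : Set (Equiv.Perm (isotropicPoints K q))) =
      q ^ 3 - p := by
  have hle := permDistSet_le_card_sub (C := (PGU K q : Set (Equiv.Perm (isotropicPoints K q))))
    (one_mem (PGU K q)) (le_ncard_fieldAut_fixed (K := K) hq)
  have hge := card_sub_le_permDistSet (v := fieldAut K p q)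
    (C := (PGU K q : Set (Equiv.Perm (isotropicPoints K q)))) ⟨1, one_mem (PGU K q)⟩
    fun c hc => ncard_fieldAut_agree_le hq hK hc
  rw [card_isotropicPoints hq hK] at hle hge
  omega

/-- The unipotent maps fixing the point at infinity bound the covering radius of `PSU(3,q)`. -/
theorem coveringRadius_PSU_le (hq : q = p ^ f) (hK : Nat.card K = q ^ 2) :
    coveringRadius (PSU K q : Set (Equiv.Perm (isotropicPoints K q))) ≤ q ^ 3 - Nat.gcd 2 q := by
  have hcard := card_isotropicPoints (K := K) hq hK
  have hq0 := q_ne_zero p hq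
  have : Nontrivial (isotropicPoints K q) := by
    rw [← Finite.one_lt_card_iff_nontrivial, hcard]
    have := Nat.pos_of_ne_zero (pow_ne_zero 3 hq0)
    omega
  have hS : Set.range (unipotentPerm (K := K) hq hK) ⊆ PSU K q := by
    rintro _ ⟨z, rfl⟩
    exact unipotentPerm_mem_PSU hq hK z
  have hfix : ∀ c ∈ Set.range (unipotentPerm (K := K) hq hK),
      c (infPoint hq0) = infPoint hq0 := by
    rintro _ ⟨z, rfl⟩
    exact unipotentPerm_infPoint hq hK z
  refine coveringRadius_le fun v => ?_
  rcases Nat.even_or_odd q with heven | hodd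
  -- Three agreements among q³ + 1 points give distance at most q³ - 2.
  · obtain ⟨c, hc, h3⟩ := exists_three_le_ncard_agree (PSU K q) _ _ hS (unipotentPerm_zero hq hK)
      hfix (existsUnique_unipotentPerm hq hK) (exists_mem_PSU_apply_eq_infPoint hq hK)
      (by rw [hcard]; exact (heven.pow_of_ne_zero three_ne_zero).add_one) v
    refine (permDistSet_le_card_sub hc h3).trans_eq ?_
    rw [hcard, Nat.gcd_eq_left heven.two_dvd]
    omega
  · obtain ⟨c, hc, h2⟩ := exists_two_le_ncard_agree (PSU K q) _ _ hS
      hfix (existsUnique_unipotentPerm hq hK) (exists_mem_PSU_apply_eq_infPoint hq hK) v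
    refine (permDistSet_le_card_sub hc h2).trans_eq ?_
    rw [hcard, Nat.coprime_two_left.2 hodd]
    omega

end Semilinear

end Unitary3

theorem theorem1p2 (p f q : ℕ) [Fact p.Prime] (hq : q = p ^ f)
    (K : Type*) [Field K] [Finite K] [CharP K p] (hK : Nat.card K = q ^ 2) :
    Nat.card (Unitary3.isotropicPoints K q) = q ^ 3 + 1 ∧
    (q ^ 3 - p ≤ coveringRadius (Unitary3.PGU K q : Set (Equiv.Perm (Unitary3.isotropicPoints K q))) ∧
      coveringRadius (Unitary3.PGU K q : Set (Equiv.Perm (Unitary3.isotropicPoints K q))) ≤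
        coveringRadius (Unitary3.PSU K q : Set (Equiv.Perm (Unitary3.isotropicPoints K q))) ∧
      coveringRadius (Unitary3.PSU K q : Set (Equiv.Perm (Unitary3.isotropicPoints K q))) ≤
        q ^ 3 - Nat.gcd 2 q) ∧
    (Even q →
      coveringRadius (Unitary3.PGU K q : Set (Equiv.Perm (Unitary3.isotropicPoints K q))) =
        q ^ 3 - 2 ∧
      coveringRadius (Unitary3.PSU K q : Set (Equiv.Perm (Unitary3.isotropicPoints K q))) =
        q ^ 3 - 2) ∧
    permDistSet (Unitary3.fieldAut K p q)
      (Unitary3.PGU K q : Set (Equiv.Perm (Unitary3.isotropicPoints K q))) = q ^ 3 - p := by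

  have hP := Unitary3.permDistSet_fieldAut (K := K) hq hK
  have hU := Unitary3.coveringRadius_PSU_le (K := K) hq hK
  have hL := permDistSet_le_coveringRadius
    (Unitary3.PGU K q : Set (Equiv.Perm (Unitary3.isotropicPoints K q))) (Unitary3.fieldAut K p q)
  have hM := coveringRadius_anti
    (C := (Unitary3.PSU K q : Set (Equiv.Perm (Unitary3.isotropicPoints K q))))
    ⟨1, one_mem _⟩ (Unitary3.PSU_le_PGU (K := K) (q := q))
  rw [hP] at hL
  refine ⟨Unitary3.card_isotropicPoints hq hK, ⟨hL, hM, hU⟩, fun heven => ?_, hP⟩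
  -- Since q is a power of `p`, evenness forces `p = 2`, and the lower bound q³ - p meets the upper
  -- bound.
  have hp : p = 2 := by
    rw [hq] at heven
    exact ((Nat.prime_dvd_prime_iff_eq Nat.prime_two Fact.out).1
      (Nat.prime_two.dvd_of_dvd_pow heven.two_dvd)).symm
  rw [Nat.gcd_eq_left heven.two_dvd] at hU
  rw [hp] at hL
  omega
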